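/- Let $n \ge 3$ and let $A$ and $B$ be real symmetric $n \times n$ matrices. For $1 \le i \le n$ let $A_i$ and $B_i$ be the matrices obtained from $A$ and $B$ by deleting the $i$-th row and the $i$-th column. Suppose that $A$ and $B$ are hypomorphic, that is, for every $i$ the matrix $B_i$ can be obtained from $A_i$ by applying one permutation simultaneously to its rows and columns (the permutation may depend on $i$). Let $\mathbf 1 = (1,\dots,1) \in \mathbb R^n$, and for a real symmetric matrix $M$ and $\lambda \in \mathbb R$ write $\mathrm{eigen}_\lambda(M) = \{v \in \mathbb R^n : Mv = \lambda v\}$. Let $\lambda$ be an eigenvalue of $A$, of any multiplicity, such that $\mathrm{eigen}_\lambda(A)$ is not orthogonal to $\mathbf 1$. Then the orthogonal projection of $\mathbf 1$ onto $\mathrm{eigen}_\lambda(A)$ equals the orthogonal projection of $\mathbf 1$ onto $\mathrm{eigen}_\lambda(B)$. -/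

import Mathlib

/-- The matrix `A_i` obtained from `A` by deleting the `i`-th row and the `i`-th column. -/
def deleteRowCol {n : ℕ} (A : Matrix (Fin n) (Fin n) ℝ) (i : Fin n) :
    Matrix {j : Fin n // j ≠ i} {j : Fin n // j ≠ i} ℝ :=
  A.submatrix Subtype.val Subtype.val

/-- `A` and `B` are hypomorphic: for every `i`, the matrix `B_i` is obtained from `A_i` by applying
one permutation simultaneously to the rows and to the columns. -/
def Hypomorphic {n : ℕ} (A B : Matrix (Fin n) (Fin n) ℝ) : Prop :=
  ∀ i : Fin n, ∃ σ : Equiv.Perm {j : Fin n // j ≠ i},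
    deleteRowCol B i = (deleteRowCol A i).submatrix σ σ

/-- The eigenspace of `A` for `μ`, as a subspace of Euclidean space. -/
noncomputable def eigenspaceOf {n : ℕ} (A : Matrix (Fin n) (Fin n) ℝ) (μ : ℝ) :
    Submodule ℝ (EuclideanSpace ℝ (Fin n)) :=
  Module.End.eigenspace (Matrix.toEuclideanLin A) μ

/-- The all-ones vector in Euclidean space. -/
noncomputable def onesVec (n : ℕ) : EuclideanSpace ℝ (Fin n) :=
  WithLp.toLp 2 (fun _ => 1)

/-! Write `J` for the all-ones matrix, `χ` for characteristic polynomials and `r_A = adj(X - A) 1`.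
The diagonal entries of `adj(X - A)` are the `χ` of the `A_i`, hence shared by `A` and `B`, and
likewise by `A + J` and `B + J`. They sum to `χ'`, so `χ_A - χ_B = p` and `χ_{A+J} - χ_{B+J} = d`
are constants. Sherman–Morrison, on the diagonal, expresses `r_A(i)²` through `χ_A`, `χ_{A+J}` and
shared entries; subtracting the version for `B` and comparing degrees forces `r_A = r_B` and then `p
= 0` (`adjRowSum_eq_of_adjugate_diag_eq`). The coefficients of `r_A` then determine all `A ^ k 1`
(`pow_mulVec_one_eq`), and a spectral projection is a polynomial in the matrix. -/

open Polynomial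

/-! ### Adjugates of characteristic matrices and rank-one updates -/

namespace Matrix

variable {m R : Type*} [Fintype m] [DecidableEq m] [CommRing R]

/-- Jacobi's formula for matrices of polynomials. -/
theorem derivative_det (M : Matrix m m R[X]) :
    derivative M.det = ∑ i, (M.updateCol i fun j => derivative (M j i)).det := by
  simp_rw [det_apply, map_sum, derivative_smul, derivative_prod_finset, Finset.smul_sum]
  rw [Finset.sum_comm]
  refine Finset.sum_congr rfl fun i _ => Finset.sum_congr rfl fun σ _ => ?_
  rw [← Finset.prod_erase_mul _ _ (Finset.mem_univ i)]
  congr 2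
  · refine Finset.prod_congr rfl fun j hj => ?_
    rw [updateCol_ne (Finset.ne_of_mem_erase hj)]
  · simp

theorem derivative_charpoly (A : Matrix m m R) :
    derivative A.charpoly = ∑ i, (charmatrix A).adjugate i i := by
  rw [charpoly, derivative_det]
  refine Finset.sum_congr rfl fun i _ => ?_
  have : (fun j => derivative (charmatrix A j i)) = Pi.single i 1 := by
    ext1 j
    by_cases h : j = i
    · subst h; simp [charmatrix_apply_eq]
    · simp [h]
  rw [this, ← cramer_apply, cramer_eq_adjugate_mulVec]
  simp

theorem adjugate_charmatrix_apply_self (A : Matrix m m R) (i : m) :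
    (charmatrix A).adjugate i i =
      (A.submatrix (Subtype.val : {j // j ≠ i} → m) Subtype.val).charpoly := by
  rw [adjugate_apply, twoBlockTriangular_det _ (fun j => j ≠ i)]
  · have h2 : (toSquareBlockProp ((charmatrix A).updateRow i (Pi.single i 1))
        (fun j => ¬ j ≠ i)).det = 1 := by
      convert! det_one (n := {j // ¬ j ≠ i}) (R := R[X]) using 2
      ext ⟨a, ha⟩ ⟨b, hb⟩ : 1
      obtain rfl : a = i := not_not.mp ha
      obtain rfl : b = a := not_not.mp hb
      simp [toSquareBlockProp_def]
    rw [h2, mul_one, charpoly]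
    congr 1
    ext ⟨a, ha⟩ ⟨b, hb⟩ : 1
    simp only [toSquareBlockProp_def, of_apply, updateRow_ne ha, charmatrix_apply,
      submatrix_apply, diagonal_apply, Subtype.mk.injEq]
  · intro a ha b hb
    obtain rfl : a = i := not_not.mp ha
    simp [hb]

variable [IsDomain R]

/-- Division-free: `M * (det M - adj M u vᵀ) = det M • (M - u vᵀ)`. The second factor on the left
has as determinant the characteristic polynomial of a rank-one matrix at `det M`; a power of `det M`
cancels. -/
theorem det_sub_vecMulVec {M : Matrix m m R} (hM : M.det ≠ 0) (u v : m → R) :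
    (M - vecMulVec u v).det = M.det - v ⬝ᵥ M.adjugate *ᵥ u := by
  rcases isEmpty_or_nonempty m with h | h
  · simp [det_isEmpty]
  have h1 : M * (scalar m M.det - vecMulVec (M.adjugate *ᵥ u) v) =
      M.det • (M - vecMulVec u v) := by
    rw [mul_sub, mul_vecMulVec, mulVec_mulVec, mul_adjugate, smul_mulVec, one_mulVec,
      smul_sub, smul_vecMulVec, scalar_apply, ← smul_one_eq_diagonal, Matrix.mul_smul, mul_one]
  have h2 := congrArg det h1
  rw [det_mul, ← eval_charpoly, charpoly_vecMulVec, det_smul] at h2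
  apply mul_left_cancel₀ (pow_ne_zero (Fintype.card m) hM)
  rw [← h2]
  obtain ⟨k, hk⟩ := Nat.exists_eq_succ_of_ne_zero (Fintype.card_ne_zero (α := m))
  simp only [hk, eval_sub, eval_pow, eval_X, Nat.succ_eq_add_one,
    Nat.add_sub_cancel, eval_smul, smul_eq_mul, dotProduct_comm v]
  ring

/-- The adjugate form of the Sherman–Morrison formula. -/
theorem det_smul_adjugate_sub_vecMulVec {M : Matrix m m R} (hM : M.det ≠ 0) (u v : m → R)
    (h : (M - vecMulVec u v).det ≠ 0) :
    M.det • (M - vecMulVec u v).adjugate =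
      (M - vecMulVec u v).det • M.adjugate +
        vecMulVec (M.adjugate *ᵥ u) (v ᵥ* M.adjugate) := by
  set N := M - vecMulVec u v with hN
  set K := N.det • M.adjugate + vecMulVec (M.adjugate *ᵥ u) (v ᵥ* M.adjugate) with hK
  have hd : N.det = M.det - v ⬝ᵥ M.adjugate *ᵥ u := det_sub_vecMulVec hM u v
  have h1 : K * N = (N.det * M.det) • 1 := by
    have e1 : M.adjugate * N = M.det • 1 - vecMulVec (M.adjugate *ᵥ u) v := by
      rw [hN, mul_sub, mul_vecMulVec, adjugate_mul]
    have e2 : (v ᵥ* M.adjugate) ᵥ* N = N.det • v := by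
      rw [vecMul_vecMul, e1, vecMul_sub, vecMul_smul, vecMul_one, vecMul_vecMulVec, hd, sub_smul]
    rw [hK, add_mul, smul_mul, e1, vecMulVec_mul, e2, vecMulVec_smul, smul_sub, smul_smul]
    simp
  have h2 : N.det • K = N.det • (M.det • N.adjugate) := by
    calc N.det • K = K * (N * N.adjugate) := by rw [mul_adjugate, Matrix.mul_smul, mul_one]
      _ = _ := by rw [← mul_assoc, h1, smul_mul, one_mul, smul_smul]
  exact (smul_right_injective _ h h2).symm

end Matrix

/-! ### Row sums of the adjugate -/

namespace Matrix

variable {m R : Type*} [Fintype m] [DecidableEq m]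

section CommRing

variable [CommRing R]

/-- The row sums of the adjugate of the characteristic matrix. -/
noncomputable def adjRowSum (A : Matrix m m R) : m → R[X] :=
  (charmatrix A).adjugate *ᵥ 1

theorem X_mul_adjRowSum (A : Matrix m m R) (i : m) :
    X * A.adjRowSum i = ∑ j, C (A i j) * A.adjRowSum j + A.charpoly := by
  have h : charmatrix A *ᵥ A.adjRowSum = A.charpoly • 1 := by
    rw [adjRowSum, mulVec_mulVec, mul_adjugate, smul_mulVec, one_mulVec, charpoly]
  have h2 := congrFun h i
  rw [charmatrix, sub_mulVec] at h2
  simp only [Pi.sub_apply, Pi.smul_apply, Pi.one_apply, smul_eq_mul, mul_one, scalar_apply,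
    mulVec_diagonal, RingHom.mapMatrix_apply] at h2
  rw [sub_eq_iff_eq_add'] at h2
  rw [h2]
  simp [mulVec, dotProduct]

theorem coeff_adjRowSum (A : Matrix m m R) (i : m) (k : ℕ) :
    (A.adjRowSum i).coeff k =
      ∑ j, A i j * (A.adjRowSum j).coeff (k + 1) + A.charpoly.coeff (k + 1) := by
  have h := congrArg (fun p => coeff p (k + 1)) (A.X_mul_adjRowSum i)
  simpa [coeff_X_mul, finsetSum_coeff] using h

theorem mulVec_coeff_zero_adjRowSum (A : Matrix m m R) (i : m) :
    ∑ j, A i j * (A.adjRowSum j).coeff 0 + A.charpoly.coeff 0 = 0 := by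
  have h := congrArg (fun p => coeff p 0) (A.X_mul_adjRowSum i)
  simpa [finsetSum_coeff] using h.symm

theorem coeff_adjRowSum_eq_zero [Nontrivial R] (A : Matrix m m R) (i : m) {k : ℕ}
    (hk : Fintype.card m ≤ k) : (A.adjRowSum i).coeff k = 0 := by
  -- Downward induction on `k` from above all degrees; `d` bounds the remaining distance.
  have key : ∀ d k : ℕ, Fintype.card m ≤ k →
      Finset.univ.sup (fun j => (A.adjRowSum j).natDegree) < k + d →
        ∀ i, (A.adjRowSum i).coeff k = 0 := by
    intro d
    induction d with
    | zero =>
      intro k _ h i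
      exact coeff_eq_zero_of_natDegree_lt
        ((Finset.le_sup (f := fun j => (A.adjRowSum j).natDegree) (Finset.mem_univ i)).trans_lt h)
    | succ d ih =>
      intro k hk h i
      rw [coeff_adjRowSum, coeff_eq_zero_of_natDegree_lt (p := A.charpoly)
        (by rw [charpoly_natDegree_eq_dim]; omega), add_zero]
      refine Finset.sum_eq_zero fun j _ => ?_
      rw [ih (k + 1) (by omega) (by omega) j, mul_zero]
  exact key (Finset.univ.sup (fun j => (A.adjRowSum j).natDegree) + 1) k hk (by omega) i

theorem coeff_adjRowSum_pred_card [Nontrivial R] (A : Matrix m m R) (i : m) :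
    (A.adjRowSum i).coeff (Fintype.card m - 1) = 1 := by
  have h : Fintype.card m - 1 + 1 = Fintype.card m :=
    Nat.sub_add_cancel (Fintype.card_pos_iff.mpr ⟨i⟩)
  rw [coeff_adjRowSum, h, Finset.sum_eq_zero, zero_add]
  · rw [← charpoly_natDegree_eq_dim A]
    exact A.charpoly_monic.coeff_natDegree
  · intro j _
    rw [coeff_adjRowSum_eq_zero A j le_rfl, mul_zero]

theorem charmatrix_add_vecMulVec_one (A : Matrix m m R) :
    charmatrix (A + vecMulVec 1 1) = charmatrix A - vecMulVec 1 1 := by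
  ext1 i j
  simp [charmatrix_apply, sub_sub]

theorem charpoly_add_vecMulVec_one [IsDomain R] (A : Matrix m m R) :
    (A + vecMulVec 1 1).charpoly = A.charpoly - ∑ i, A.adjRowSum i := by
  rw [charpoly, charmatrix_add_vecMulVec_one, det_sub_vecMulVec A.charpoly_monic.ne_zero,
    one_dotProduct, charpoly, adjRowSum]

theorem adjRowSum_sq [IsDomain R] {A : Matrix m m R} (hA : A.IsSymm) (i : m) :
    A.adjRowSum i ^ 2 = A.charpoly * (charmatrix (A + vecMulVec 1 1)).adjugate i i -
      (A + vecMulVec 1 1).charpoly * (charmatrix A).adjugate i i := by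
  have h1 : charmatrix (A + vecMulVec 1 1) = charmatrix A - vecMulVec 1 1 :=
    charmatrix_add_vecMulVec_one A
  have h := det_smul_adjugate_sub_vecMulVec A.charpoly_monic.ne_zero 1 1
    (by rw [← h1]; exact (A + vecMulVec 1 1).charpoly_monic.ne_zero)
  have hs : 1 ᵥ* (charmatrix A).adjugate = A.adjRowSum := by
    rw [adjRowSum, ← mulVec_transpose, adjugate_transpose, ← charmatrix_transpose, hA.eq]
  rw [hs, ← h1] at h
  have h2 := congrFun (congrFun h i) i
  simp only [smul_apply, add_apply, smul_eq_mul, vecMulVec_apply] at h2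
  rw [charpoly, charpoly, h2, adjRowSum]
  ring

theorem natDegree_adjugate_charmatrix_apply_self [Nontrivial R] (A : Matrix m m R) (i : m) :
    ((charmatrix A).adjugate i i).natDegree = Fintype.card m - 1 := by
  rw [adjugate_charmatrix_apply_self, charpoly_natDegree_eq_dim]
  simp

theorem coeff_adjugate_charmatrix_apply_self [Nontrivial R] (A : Matrix m m R) (i : m) :
    ((charmatrix A).adjugate i i).coeff (Fintype.card m - 1) = 1 := by
  rw [← natDegree_adjugate_charmatrix_apply_self A i, coeff_natDegree,
    adjugate_charmatrix_apply_self]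
  exact charpoly_monic _

/-- By the coefficient recursion, the span of the coefficient vectors of `adjRowSum` is stable under
`A`, and `A` and `B` agree on it. It contains `1`, the top coefficient. -/
theorem pow_mulVec_one_eq [Nontrivial R] {A B : Matrix m m R} (hs : A.adjRowSum = B.adjRowSum)
    (hc : A.charpoly = B.charpoly) (k : ℕ) : A ^ k *ᵥ 1 = B ^ k *ᵥ 1 := by
  let a : ℕ → m → R := fun k i => (A.adjRowSum i).coeff k
  have hone : a (Fintype.card m - 1) = 1 := funext fun i => coeff_adjRowSum_pred_card A i
  let S := Submodule.span R (Set.range a)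
  have h1S : (1 : m → R) ∈ S := Submodule.subset_span ⟨_, hone⟩
  have hsucc (M : Matrix m m R) (hM : M.adjRowSum = A.adjRowSum) (k : ℕ) :
      M *ᵥ a (k + 1) = a k - M.charpoly.coeff (k + 1) • 1 := by
    ext i
    have := coeff_adjRowSum M i k
    simp only [hM] at this
    simp [mulVec, dotProduct, a, this]
  have hzero (M : Matrix m m R) (hM : M.adjRowSum = A.adjRowSum) :
      M *ᵥ a 0 = - M.charpoly.coeff 0 • 1 := by
    ext i
    have := mulVec_coeff_zero_adjRowSum M i
    simp only [hM] at this
    simpa [mulVec, dotProduct, a] using eq_neg_of_add_eq_zero_left this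
  have hS (v : m → R) (hv : v ∈ S) : A *ᵥ v ∈ S ∧ A *ᵥ v = B *ᵥ v := by
    induction hv using Submodule.span_induction with
    | mem v hv =>
      obtain ⟨k, rfl⟩ := hv
      cases k with
      | zero =>
        rw [hzero A rfl, hzero B hs.symm, hc]
        exact ⟨S.smul_mem _ h1S, rfl⟩
      | succ k =>
        rw [hsucc A rfl, hsucc B hs.symm, hc]
        exact ⟨S.sub_mem (Submodule.subset_span ⟨k, rfl⟩) (S.smul_mem _ h1S), rfl⟩
    | zero => simp
    | add v w _ _ h1 h2 =>
      rw [mulVec_add, mulVec_add, h1.2, h2.2]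
      exact ⟨S.add_mem (h1.2 ▸ h1.1) (h2.2 ▸ h2.1), rfl⟩
    | smul c v _ h =>
      rw [mulVec_smul, mulVec_smul, h.2]
      exact ⟨S.smul_mem _ (h.2 ▸ h.1), rfl⟩
  have key : A ^ k *ᵥ 1 ∈ S ∧ A ^ k *ᵥ 1 = B ^ k *ᵥ 1 := by
    induction k with
    | zero => simpa using h1S
    | succ k ih =>
      have := hS _ ih.1
      rw [pow_succ', pow_succ', ← mulVec_mulVec, ← mulVec_mulVec, ← ih.2]
      exact this
  exact key.2

end CommRing

/-! ### Recovering the row sums and the characteristic polynomial -/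

section Field

variable [Field R] [CharZero R]

theorem charpoly_sub_charpoly_eq_C {A B : Matrix m m R}
    (h : ∀ i, (charmatrix A).adjugate i i = (charmatrix B).adjugate i i) :
    ∃ c, A.charpoly - B.charpoly = C c := by
  refine ⟨_, eq_C_of_derivative_eq_zero ?_⟩
  rw [derivative_sub, derivative_charpoly, derivative_charpoly, sub_eq_zero]
  exact Finset.sum_congr rfl fun i _ => h i

theorem adjRowSum_eq_of_adjugate_diag_eq (hm : 3 ≤ Fintype.card m) {A B : Matrix m m R}
    (hA : A.IsSymm) (hB : B.IsSymm)
    (h : ∀ i, (charmatrix A).adjugate i i = (charmatrix B).adjugate i i)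
    (h' : ∀ i, (charmatrix (A + vecMulVec 1 1)).adjugate i i =
      (charmatrix (B + vecMulVec 1 1)).adjugate i i) :
    A.adjRowSum = B.adjRowSum ∧ A.charpoly = B.charpoly := by
  obtain ⟨p, hp⟩ := charpoly_sub_charpoly_eq_C h
  obtain ⟨d, hd⟩ := charpoly_sub_charpoly_eq_C h'
  set N := Fintype.card m - 1 with hN
  have hsq (i : m) : (A.adjRowSum i - B.adjRowSum i) * (A.adjRowSum i + B.adjRowSum i) =
      C p * (charmatrix (A + vecMulVec 1 1)).adjugate i i -
        C d * (charmatrix A).adjugate i i := by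
    have e1 := adjRowSum_sq hA i
    have e2 := adjRowSum_sq hB i
    rw [← h, ← h'] at e2
    rw [← hp, ← hd]
    linear_combination e1 - e2
  have hcoeff (i : m) : (A.adjRowSum i + B.adjRowSum i).coeff N = 2 := by
    rw [coeff_add, coeff_adjRowSum_pred_card, coeff_adjRowSum_pred_card]
    norm_num
  have hdeg (i : m) : (A.adjRowSum i + B.adjRowSum i).natDegree = N := by
    refine natDegree_eq_of_le_of_coeff_ne_zero ?_ (by rw [hcoeff]; exact two_ne_zero)
    rw [natDegree_le_iff_coeff_eq_zero]
    intro k hk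
    rw [coeff_add, coeff_adjRowSum_eq_zero A i (by omega), coeff_adjRowSum_eq_zero B i (by omega),
      add_zero]
  have hconst (i : m) : A.adjRowSum i - B.adjRowSum i = C ((p - d) / 2) := by
    have hne : A.adjRowSum i + B.adjRowSum i ≠ 0 := fun h0 => by
      have := hcoeff i
      simp [h0] at this
    -- In `hsq` the right side has degree at most `N`, which the factor `r_A + r_B` already uses up.
    have hd0 : (A.adjRowSum i - B.adjRowSum i).natDegree = 0 := by
      by_cases hz : A.adjRowSum i - B.adjRowSum i = 0
      · rw [hz, natDegree_zero]
      have e := congrArg natDegree (hsq i)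
      rw [natDegree_mul hz hne, hdeg] at e
      have : (C p * (charmatrix (A + vecMulVec 1 1)).adjugate i i -
          C d * (charmatrix A).adjugate i i).natDegree ≤ N := by
        refine (natDegree_sub_le _ _).trans (max_le ?_ ?_)
        · exact (natDegree_C_mul_le _ _).trans (natDegree_adjugate_charmatrix_apply_self _ _).le
        · exact (natDegree_C_mul_le _ _).trans (natDegree_adjugate_charmatrix_apply_self _ _).le
      omega
    obtain ⟨e, he⟩ := natDegree_eq_zero.mp hd0
    have e2 := congrArg (fun q => coeff q N) (hsq i)
    simp only [← he, coeff_C_mul, coeff_sub, hcoeff] at e2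
    rw [coeff_adjugate_charmatrix_apply_self, coeff_adjugate_charmatrix_apply_self] at e2
    rw [← he, ← mul_one p, ← mul_one d, ← e2, mul_div_cancel_right₀ _ two_ne_zero]
  -- Summing over `i` gives `d = p - n (p - d) / 2`, so `n ≠ 2` is what is needed.
  have hpd : p - d = 0 := by
    have e1 : C d = C p - ∑ i, (A.adjRowSum i - B.adjRowSum i) := by
      rw [← hp, ← hd, charpoly_add_vecMulVec_one, charpoly_add_vecMulVec_one,
        Finset.sum_sub_distrib]
      ring
    simp only [hconst, Finset.sum_const, Finset.card_univ, ← map_nsmul, ← map_sub] at e1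
    have e2 := C_injective e1
    have e3 : (p - d) * ((Fintype.card m : R) - 2) = 0 := by
      rw [nsmul_eq_mul] at e2
      linear_combination 2 * e2
    refine (mul_eq_zero.mp e3).resolve_right ?_
    rw [← ne_eq, sub_ne_zero]
    exact_mod_cast (by omega : Fintype.card m ≠ 2)
  have hs : A.adjRowSum = B.adjRowSum := by
    ext1 i
    rw [← sub_eq_zero, hconst, hpd, zero_div, C_0]
  refine ⟨hs, ?_⟩
  -- With `r_A = r_B` and `p = d`, summing `hsq` over `i` gives `p * (∑ r_A)' = 0`, and `∑ r_A` has
  -- leading term `n X ^ (n - 1)`.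
  have hp0 : p = 0 := by
    have e1 : ∑ i, C p * ((charmatrix A).adjugate i i -
        (charmatrix (A + vecMulVec 1 1)).adjugate i i) = 0 := by
      refine Finset.sum_eq_zero fun i _ => ?_
      have := hsq i
      rw [hs, sub_self, zero_mul, ← sub_eq_zero.mp hpd] at this
      linear_combination this
    rw [← Finset.mul_sum, Finset.sum_sub_distrib, ← derivative_charpoly, ← derivative_charpoly,
      charpoly_add_vecMulVec_one, derivative_sub, sub_sub_cancel] at e1
    have e2 := congrArg (fun q => coeff q (N - 1)) e1
    have hN1 : N - 1 + 1 = N := by omega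
    have hA1 (i : m) : (A.adjRowSum i).coeff N = 1 := coeff_adjRowSum_pred_card A i
    simp only [coeff_C_mul, coeff_derivative, hN1, finsetSum_coeff, hA1, Finset.sum_const,
      Finset.card_univ, nsmul_eq_mul, mul_one, coeff_zero] at e2
    refine (mul_eq_zero.mp e2).resolve_right (mul_ne_zero ?_ ?_)
    · exact_mod_cast (by omega : Fintype.card m ≠ 0)
    · exact_mod_cast (by omega : N - 1 + 1 ≠ 0)
  rw [← sub_eq_zero, hp, hp0, C_0]

end Field

end Matrix

/-! ### Spectral projections as polynomials -/

section

variable {E : Type*} [NormedAddCommGroup E] [InnerProductSpace ℝ E]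

theorem LinearMap.IsSymmetric.inner_aeval_left {T : E →ₗ[ℝ] E} (hT : T.IsSymmetric) (q : ℝ[X])
    {μ : ℝ} {w : E} (hw : w ∈ Module.End.eigenspace T μ) (x : E) :
    inner ℝ (aeval T q x) w = q.eval μ * inner ℝ x w := by
  have hw' : T w = μ • w := Module.End.mem_eigenspace_iff.mp hw
  induction q using Polynomial.induction_on' with
  | add p q hp hq => simp [inner_add_left, hp, hq, add_mul]
  | monomial k c =>
    have hk : ∀ x, inner ℝ ((T ^ k) x) w = μ ^ k * inner ℝ x w := by
      induction k with
      | zero => simp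
      | succ k ih =>
        intro x
        rw [pow_succ, Module.End.mul_apply, ih, hT, hw', inner_smul_right]
        ring
    simp [aeval_monomial, inner_smul_left, hk, Module.algebraMap_end_apply]
    ring

/-- The projection to an eigenspace of a symmetric operator is a polynomial in the operator. -/
theorem LinearMap.IsSymmetric.starProjection_eigenspace_eq_aeval [FiniteDimensional ℝ E] {T : E →ₗ[ℝ] E}
    (hT : T.IsSymmetric) {q : ℝ[X]} {μ : ℝ} (h1 : q.eval μ = 1)
    (h0 : ∀ ν, Module.End.HasEigenvalue T ν → ν ≠ μ → q.eval ν = 0) (x : E) :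
    (Module.End.eigenspace T μ).starProjection x = aeval T q x := by
  refine Submodule.eq_starProjection_of_mem_of_inner_eq_zero ?_ ?_
  · rw [Module.End.mem_eigenspace_iff, ← sub_eq_zero]
    let b := hT.eigenvectorBasis rfl
    refine InnerProductSpace.ext_inner_right_basis b.toBasis fun i => ?_
    have hb := hT.hasEigenvector_eigenvectorBasis rfl i
    have hbm := hb.1
    have hbT : T (b i) = hT.eigenvalues rfl i • b i := Module.End.mem_eigenspace_iff.mp hbm
    simp only [OrthonormalBasis.coe_toBasis, inner_zero_left, inner_sub_left, inner_smul_left,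
      hT _ (b i)]
    rw [hbT, inner_smul_right, LinearMap.IsSymmetric.inner_aeval_left hT q hbm]
    by_cases h : hT.eigenvalues rfl i = μ
    · simp [h]
    · rw [h0 _ (Module.End.hasEigenvalue_of_hasEigenvector hb) h]
      simp
  · intro w hw
    rw [inner_sub_left, LinearMap.IsSymmetric.inner_aeval_left hT q hw, h1, one_mul, sub_self]

end

/-! ### Application to hypomorphic matrices -/

theorem Hypomorphic.adjugate_charmatrix_apply_self {n : ℕ} {A B : Matrix (Fin n) (Fin n) ℝ}
    (h : Hypomorphic A B) (i : Fin n) :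
    A.charmatrix.adjugate i i = B.charmatrix.adjugate i i := by
  obtain ⟨σ, hσ⟩ := h i
  rw [Matrix.adjugate_charmatrix_apply_self, Matrix.adjugate_charmatrix_apply_self]
  have := Matrix.charpoly_reindex σ.symm (deleteRowCol A i)
  rw [Matrix.reindex_apply, Equiv.symm_symm, ← hσ] at this
  exact this.symm

theorem Hypomorphic.add_vecMulVec_one {n : ℕ} {A B : Matrix (Fin n) (Fin n) ℝ}
    (h : Hypomorphic A B) :
    Hypomorphic (A + Matrix.vecMulVec 1 1) (B + Matrix.vecMulVec 1 1) := by
  intro i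
  obtain ⟨σ, hσ⟩ := h i
  refine ⟨σ, ?_⟩
  ext a b
  have := congrFun (congrFun hσ a) b
  simp only [deleteRowCol, Matrix.submatrix_apply] at this
  simp [deleteRowCol, this]

theorem aeval_toEuclideanLin_onesVec {n : ℕ} (A : Matrix (Fin n) (Fin n) ℝ) (q : ℝ[X]) :
    aeval (Matrix.toEuclideanLin A) q (onesVec n) =
      q.sum fun k c => c • WithLp.toLp 2 ((A ^ k).mulVec 1) := by
  have hk (k : ℕ) : (Matrix.toEuclideanLin A ^ k) (onesVec n) = WithLp.toLp 2 ((A ^ k).mulVec 1) := by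
    induction k with
    | zero => simp [onesVec]; rfl
    | succ k ih =>
      rw [pow_succ', Module.End.mul_apply, ih, pow_succ', ← Matrix.mulVec_mulVec]
      rfl
  rw [aeval_eq_sum_range, Polynomial.sum_over_range _ (by simp)]
  simp [LinearMap.sum_apply, hk]

theorem mainTheorem5 (n : ℕ) (hn : 3 ≤ n) (A B : Matrix (Fin n) (Fin n) ℝ)
    (hA : A.IsSymm) (hB : B.IsSymm) (hAB : Hypomorphic A B)
    (μ : ℝ) (hμ : Module.End.HasEigenvalue (Matrix.toEuclideanLin A) μ)
    (hone : ∃ v ∈ eigenspaceOf A μ, inner ℝ v (onesVec n) ≠ 0) :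
    (eigenspaceOf A μ).starProjection (onesVec n) =
      (eigenspaceOf B μ).starProjection (onesVec n) := by
  obtain ⟨hs, hc⟩ := Matrix.adjRowSum_eq_of_adjugate_diag_eq (by simpa using hn) hA hB
    hAB.adjugate_charmatrix_apply_self hAB.add_vecMulVec_one.adjugate_charmatrix_apply_self
  have hsym {M : Matrix (Fin n) (Fin n) ℝ} (hM : M.IsSymm) :
      (Matrix.toEuclideanLin M).IsSymmetric := by
    rw [Matrix.isSymmetric_toEuclideanLin_iff]
    simpa [Matrix.IsHermitian, Matrix.conjTranspose_eq_transpose_of_trivial] using hM.eq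
  have hfin (M : Matrix (Fin n) (Fin n) ℝ) :
      {ν | Module.End.HasEigenvalue (Matrix.toEuclideanLin M) ν}.Finite :=
    Module.End.finite_hasEigenvalue _
  -- Both spectra are nodes, so one `q` serves `A` and `B`; inserting `μ` avoids having to know that
  -- it is an eigenvalue of `B`.
  let s := insert μ ((hfin A).toFinset ∪ (hfin B).toFinset)
  let q : ℝ[X] := Lagrange.basis s id μ
  have h1 : q.eval μ = 1 :=
    Lagrange.eval_basis_self Function.injective_id.injOn (Finset.mem_insert_self _ _)
  have h0 (ν : ℝ) (hν : ν ∈ s) (hne : ν ≠ μ) : q.eval ν = 0 :=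
    Lagrange.eval_basis_of_ne (v := id) hne.symm hν
  rw [eigenspaceOf, eigenspaceOf,
    (hsym hA).starProjection_eigenspace_eq_aeval h1 fun ν hν hne => h0 ν (by simp [s, hν]) hne,
    (hsym hB).starProjection_eigenspace_eq_aeval h1 fun ν hν hne => h0 ν (by simp [s, hν]) hne,
    aeval_toEuclideanLin_onesVec, aeval_toEuclideanLin_onesVec]
  simp only [Matrix.pow_mulVec_one_eq hs hc]
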